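/- Let $r,n\ge 1$ and let $G_{r,n}=\mathbb{Z}_r\wr S_n$ be the group of colored permutations: its elements are the pairs $\pi=(z,\tau)$ with $z\in\mathbb{Z}_r^n$, $\tau\in S_n$, and $\pi$ acts on $\Sigma=\{i^{[j]}: 1\le i\le n,\ j\in\mathbb Z_r=\{0,\dots,r-1\}\}$ by $\pi(i^{[j]})=\tau(i)^{[j+z_{\tau(i)}]}$, colors being added modulo $r$. Order $\Sigma$ by $1^{[r-1]}<\cdots<n^{[r-1]}<1^{[r-2]}<\cdots<n^{[r-2]}<\cdots<1^{[0]}<\cdots<n^{[0]}$. The excedance matrix $M(\pi)=(t_i^j)$ has columns $i=1,\dots,n$ and rows $j=r-1,\dots,0$ (from top to bottom), with $t_i^j=b$ if $\pi(i^{[j]})>i^{[j]}$ and $t_i^j=a$ otherwise. The word associated with an $r\times n$ matrix over $\{a,b\}$ is obtained by reading its entries row by row, from left to right, omitting the last entry; $w_\pi$ is the word associated with $M(\pi)$. For $w\in\{a,b\}^{rn-1}$ let $[w]=\#\{\pi\in G_{r,n}: w_\pi=w\}$. For an $r\times n$ matrix $M=(t_i^j)$ over $\{a,b\}$ with associated word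 $w$, let $\Psi(w)=w'_1\cdots w'_{n-1}$, where $w'_i=a$ if all entries of column $i$ are $a$, $w'_i=b$ if they are all $b$, and $w'_i=a+b$ otherwise. Let $[\Psi(w)]$ be the number of $\sigma\in S_n$ such that for each $i\in\{1,\dots,n-1\}$: $\sigma(i)\le i$ if $w'_i=a$, and $\sigma(i)>i$ if $w'_i=b$ (there is no condition at $i$ if $w'_i=a+b$). Write $\Psi(w)=a^{n_1}x_1a^{n_2}x_2\cdots x_ka^{n_{k+1}}$ with $n_i\ge 0$ and $x_i\in\{b,a+b\}$, and put ${\bf n}(w)=(n_1,\dots,n_{k+1})$, ${\bf 1}=(1,\dots,1)$ and $I(w)=\{i\in\{1,\dots,k\}: x_i=a+b\}$. Let $$R_k=\{{\bf r}=(r_1,\dots,r_{k+1}) : r_1=1,\ r_{i+1}-r_i\in\{0,1\}\text{ for }1\le i\le k,\ r_{i+1}-r_i=1\text{ if }i\in I(w)\},$$ $h({\bf r})=\#\{i\in\{1,\dots,k\}: r_i=r_{i+1}\}$ and ${\bf r}^{{\bf n}(w)+{\bf 1}}=\prod_{i=1}^{k+1}r_i^{n_i+1}$. Theorem. If $w$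 is the word of some colored permutation, that is, $w=w_\pi$ for some $\pi\in G_{r,n}$, then $$[w]=[\Psi(w)]=\sum_{{\bf r}\in R_k}(-1)^{h({\bf r})}\,{\bf r}^{{\bf n}(w)+{\bf 1}}.$$ The second equality holds for the word $w$ of every $r\times n$ matrix over $\{a,b\}$, whether or not $w$ comes from a colored permutation. -/

import Mathlib

namespace ColoredExc

/-- The letters of excedance words. -/
inductive Letter
  | a
  | b
  deriving DecidableEq

/-- The letters `a`, `b` and `a+b`; the last one, `ab`, means "either of `a`, `b`". -/
inductive ELetter
  | a
  | b
  | ab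
  deriving DecidableEq

/-- The group `G_{r,n} = ℤ_r ≀ S_n` of colored permutations: pairs `(z, τ)`. -/
@[ext]
structure ColoredPerm (r n : ℕ) where
  z : Fin n → ZMod r
  τ : Equiv.Perm (Fin n)

namespace ColoredPerm

variable {r n : ℕ}

instance : Mul (ColoredPerm r n) :=
  ⟨fun π σ => ⟨fun i => π.z i + σ.z (π.τ.symm i), π.τ * σ.τ⟩⟩

instance : One (ColoredPerm r n) := ⟨⟨fun _ => 0, 1⟩⟩

instance : Inv (ColoredPerm r n) := ⟨fun π => ⟨fun i => -π.z (π.τ i), π.τ⁻¹⟩⟩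

@[simp] theorem mul_z (π σ : ColoredPerm r n) (i : Fin n) :
    (π * σ).z i = π.z i + σ.z (π.τ.symm i) := rfl

@[simp] theorem mul_τ (π σ : ColoredPerm r n) : (π * σ).τ = π.τ * σ.τ := rfl

@[simp] theorem one_z (i : Fin n) : (1 : ColoredPerm r n).z i = 0 := rfl

@[simp] theorem one_τ : (1 : ColoredPerm r n).τ = 1 := rfl

@[simp] theorem inv_z (π : ColoredPerm r n) (i : Fin n) : (π⁻¹).z i = -π.z (π.τ i) := rfl

@[simp] theorem inv_τ (π : ColoredPerm r n) : (π⁻¹).τ = π.τ⁻¹ := rfl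

instance : Group (ColoredPerm r n) :=
  Group.ofLeftAxioms
    (fun π σ ρ => by
      ext i
      · simp [add_assoc, Equiv.Perm.mul_def]
      · simp)
    (fun π => by
      ext i
      · simp [← Equiv.Perm.inv_def]
      · simp)
    (fun π => by
      ext i
      · simp [← Equiv.Perm.inv_def]
      · simp)

/-- A letter `i^{[α]}` of the colored alphabet `Σ` is the pair `(i, α)`. A colored permutation
acts on `Σ` by `i^{[α]} ↦ τ(i)^{[α + z_{τ(i)}]}` (this is its complete notation). -/
instance : MulAction (ColoredPerm r n) (Fin n × ZMod r) where
  smul π x := (π.τ x.1, x.2 + π.z (π.τ x.1))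
  one_smul x := by
    change ((1 : ColoredPerm r n).τ x.1, x.2 + (1 : ColoredPerm r n).z _) = x
    simp
  mul_smul π σ x := by
    change ((π * σ).τ x.1, x.2 + (π * σ).z ((π * σ).τ x.1)) =
      (π.τ (σ.τ x.1), x.2 + σ.z (σ.τ x.1) + π.z (π.τ (σ.τ x.1)))
    simp [add_comm, add_left_comm]

end ColoredPerm

/-- The strict color order on `Σ`:
`1^{[r-1]} < ⋯ < n^{[r-1]} < 1^{[r-2]} < ⋯ < n^{[r-2]} < ⋯ < 1^{[0]} < ⋯ < n^{[0]}`. -/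
def ColorLT {r n : ℕ} (x y : Fin n × ZMod r) : Prop :=
  y.2.val < x.2.val ∨ (x.2 = y.2 ∧ x.1 < y.1)

open Classical in
/-- The excedance matrix `M(π)`. Its rows from top to bottom belong to the colors
`r-1, r-2, …, 0`, so row `p` belongs to the color `r-1-p`. -/
noncomputable def excMatrix {r n : ℕ} (π : ColoredPerm r n) : Matrix (Fin r) (Fin n) Letter :=
  fun p i =>
    let x : Fin n × ZMod r := (i, ((p.rev : ℕ) : ZMod r))
    if ColorLT x (π • x) then Letter.b else Letter.a

/-- The word associated with a matrix: read it row by row, from left to right, ignoring the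
last place. -/
def matrixWord {r n : ℕ} (M : Matrix (Fin r) (Fin n) Letter) : List Letter :=
  ((List.finRange r).flatMap fun p => List.ofFn (M p)).dropLast

/-- The excedance word `w_π` of a colored permutation. -/
noncomputable def excWord {r n : ℕ} (π : ColoredPerm r n) : List Letter :=
  matrixWord (excMatrix π)

/-- `[w]`: the number of `π ∈ G_{r,n}` with excedance word `w`. -/
noncomputable def bracket (r n : ℕ) (w : List Letter) : ℕ :=
  Nat.card {π : ColoredPerm r n // excWord π = w}

/-- The excedance word, of length `n-1`, of an ordinary permutation. -/
def permWord {n : ℕ} (σ : Equiv.Perm (Fin n)) : List Letter :=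
  (List.ofFn fun i => if i < σ i then Letter.b else Letter.a).dropLast

/-- Which letters are allowed at a place marked by `a`, `b` or `a+b`. -/
def ELetter.Allows : ELetter → Letter → Prop
  | .a, x => x = Letter.a
  | .b, x => x = Letter.b
  | .ab, _ => True

/-- `[v]` for a word `v` in `a`, `b`, `a+b`: the number of `σ ∈ S_n` whose excedance word agrees
with `v`, where the places marked `a+b` are disregarded. -/
noncomputable def permBracket (n : ℕ) (v : List ELetter) : ℕ :=
  Nat.card {σ : Equiv.Perm (Fin n) // List.Forall₂ ELetter.Allows v (permWord σ)}

/-- A column is collapsed to `a` or `b` if it is constant, and to `a+b` otherwise. -/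
def collapse {r : ℕ} (c : Fin r → Letter) : ELetter :=
  if ∀ p, c p = Letter.a then ELetter.a
  else if ∀ p, c p = Letter.b then ELetter.b
  else ELetter.ab

/-- The map `Ψ`: collapse the columns `1, …, n-1`. -/
def Psi {r n : ℕ} (M : Matrix (Fin r) (Fin n) Letter) : List ELetter :=
  (List.ofFn fun i : Fin n => collapse fun p => M p i).dropLast

/-- The letters `x₁, …, x_k` of `v = a^{n₁} x₁ a^{n₂} x₂ ⋯ x_k a^{n_{k+1}}` other than `a`. -/
def nonA (v : List ELetter) : List ELetter := v.filter (· ≠ ELetter.a)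

/-- The exponents `n₁, …, n_{k+1}` of `v = a^{n₁} x₁ a^{n₂} x₂ ⋯ x_k a^{n_{k+1}}`. -/
def runs : List ELetter → List ℕ
  | [] => [0]
  | ELetter.a :: v => (runs v).modifyHead (· + 1)
  | ELetter.b :: v => 0 :: runs v
  | ELetter.ab :: v => 0 :: runs v

theorem runs_length (v : List ELetter) : (runs v).length = (nonA v).length + 1 := by
  induction v with
  | nil => rfl
  | cons x v ih => cases x <;> simp_all [runs, nonA]

/-- The vector `n(v) = (n₁, …, n_{k+1})`. -/
def nVec (v : List ELetter) (i : Fin ((nonA v).length + 1)) : ℕ :=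
  (runs v).get (i.cast (runs_length v).symm)

/-- The condition defining `R_k`: `r₁ = 1`, each step `r_{i+1} - r_i` is `0` or `1`, and it is `1`
if `x_i = a+b`. -/
def IsLatticeVector (v : List ELetter) (ρ : Fin ((nonA v).length + 1) → ℕ) : Prop :=
  ρ 0 = 1 ∧ ∀ i : Fin (nonA v).length,
    (ρ i.succ = ρ i.castSucc ∨ ρ i.succ = ρ i.castSucc + 1) ∧
    ((nonA v).get i = ELetter.ab → ρ i.succ = ρ i.castSucc + 1)

theorem finite_latticeVectors (v : List ELetter) : {ρ | IsLatticeVector v ρ}.Finite := by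
  refine (Fintype.piFinset fun _ : Fin ((nonA v).length + 1) =>
    Finset.range ((nonA v).length + 2)).finite_toSet.subset ?_
  rintro ρ ⟨h0, h1⟩
  have key : ∀ i : Fin ((nonA v).length + 1), ρ i ≤ (i : ℕ) + 1 := by
    intro i
    induction i using Fin.induction with
    | zero => simp [h0]
    | succ i ih =>
      have := (h1 i).1
      simp only [Fin.val_castSucc, Fin.val_succ] at ih ⊢
      omega
  simp only [Finset.mem_coe, Fintype.mem_piFinset, Finset.mem_range]
  intro i
  have := key i
  omega

/-- The finite set `R_k` of lattice vectors. -/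
noncomputable def latticeVectors (v : List ELetter) :
    Finset (Fin ((nonA v).length + 1) → ℕ) :=
  (finite_latticeVectors v).toFinset

/-- `h(r)`: the number of `i ∈ {1, …, k}` with `r_i = r_{i+1}`. -/
def hSteps {k : ℕ} (ρ : Fin (k + 1) → ℕ) : ℕ :=
  (Finset.univ.filter fun i : Fin k => ρ i.castSucc = ρ i.succ).card

end ColoredExc

/-!
Let `c` be the color that `π` adds to the letter `i`. If `c ≠ 0`, then column `i` of `M(π)` has `b`
in its top `c` rows and `a` below; if `c = 0`, the column is constant, with entry `b` exactly when
`i < τ(i)`. The omitted last entry is always `a`. So the number of `b`s in a column is congruent to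
`c` modulo `r`, a given word forces all colors, and all that it asks of `τ` is the condition
expressed by `Ψ`.

For the second equality, let `N(d, v)` be the number of permutations that obey `d` letters `a+b`
followed by the word `v`. A leading `a+b` of `v` just raises `d` by one. If `v` begins with `a`, the
letter stands at the place `d + 1` and admits `d + 1` values; deleting the place and the value
shifts each later place and the values it is compared with alike, so that
`N(d, av) = (d + 1) N(d, v)`. A leading `b` gives the difference of the two. Apart from the factor
`d!`, the signed sums over the vectors that start at `d + 1` instead of `1` satisfy the same
recursion.
-/

namespace ColoredExc

open Equiv

/-! ### Signed sums over lattice vectors -/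

/-- The term `(-1)^{h(ρ)} ρ^{ν + 1}` that a lattice vector `ρ` contributes. -/
def signedMonomial {k : ℕ} (ν ρ : Fin (k + 1) → ℕ) : ℤ :=
  (-1) ^ hSteps ρ * ∏ i, (ρ i : ℤ) ^ (ν i + 1)

/-- A component `s` of a lattice vector may be followed by `t` across the letter `x`. -/
def IsStep (x : ELetter) (s t : ℕ) : Prop :=
  (t = s ∨ t = s + 1) ∧ (x = .ab → t = s + 1)

/-- The vectors that start at `m` and otherwise obey the conditions of `R_k` for the letters `u`,
so that those starting at `1` are the lattice vectors. The start is free for the sake of the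
recursion on `u`. -/
def stepVectors : (u : List ELetter) → (m : ℕ) → Finset (Fin (u.length + 1) → ℕ)
  | [], m => {fun _ => m}
  | x :: u, m =>
    (stepVectors u (m + 1) ∪ if x = .ab then ∅ else stepVectors u m).image
      fun ρ => (Fin.cons m ρ : Fin (u.length + 2) → ℕ)

/-- The signed sum of the theorem for `v`, over the vectors starting at `m` instead of `1`. -/
def latticeSum (v : List ELetter) (m : ℕ) : ℤ :=
  ∑ ρ ∈ stepVectors (nonA v) m, signedMonomial (nVec v) ρ

theorem hSteps_cons {k : ℕ} (m : ℕ) (ρ : Fin (k + 1) → ℕ) :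
    hSteps (Fin.cons m ρ : Fin (k + 2) → ℕ) = (if m = ρ 0 then 1 else 0) + hSteps ρ := by
  simp only [hSteps, Finset.card_filter, Fin.sum_univ_succ (n := k)]
  rfl

theorem signedMonomial_cons {k : ℕ} (ν : Fin (k + 2) → ℕ) (m : ℕ) (ρ : Fin (k + 1) → ℕ) :
    signedMonomial ν (Fin.cons m ρ : Fin (k + 2) → ℕ) =
      (if m = ρ 0 then -1 else 1) * (m : ℤ) ^ (ν 0 + 1) * signedMonomial (Fin.tail ν) ρ := by
  rw [signedMonomial, hSteps_cons, Fin.prod_univ_succ]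
  simp only [signedMonomial, Fin.cons_zero, Fin.cons_succ, Fin.tail, pow_add]
  split_ifs <;> ring

theorem signedMonomial_add_single_zero {k : ℕ} (ν ρ : Fin (k + 1) → ℕ) :
    signedMonomial (ν + Pi.single 0 1) ρ = ρ 0 * signedMonomial ν ρ := by
  simp only [signedMonomial, Fin.prod_univ_succ, Pi.add_apply, Pi.single_eq_same,
    Pi.single_eq_of_ne (Fin.succ_ne_zero _), add_zero]
  ring

theorem isStep_iff {x : ELetter} {s t : ℕ} : IsStep x s t ↔ t = s + 1 ∨ x ≠ .ab ∧ t = s := by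
  unfold IsStep
  grind

theorem mem_stepVectors_cons {x : ELetter} {u : List ELetter} {m : ℕ}
    {ρ : Fin (u.length + 2) → ℕ} :
    ρ ∈ stepVectors (x :: u) m ↔ ρ 0 = m ∧
      (Fin.tail ρ ∈ stepVectors u (m + 1) ∨ x ≠ .ab ∧ Fin.tail ρ ∈ stepVectors u m) := by
  have mem_union (ρ' : Fin (u.length + 1) → ℕ) :
      (ρ' ∈ stepVectors u (m + 1) ∪ if x = .ab then ∅ else stepVectors u m) ↔
        ρ' ∈ stepVectors u (m + 1) ∨ x ≠ .ab ∧ ρ' ∈ stepVectors u m := by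
    split_ifs with hx <;> simp [hx]
  simp only [stepVectors, Finset.mem_image, mem_union]
  constructor
  · rintro ⟨ρ', hρ', rfl⟩
    exact ⟨rfl, hρ'⟩
  · rintro ⟨rfl, hρ⟩
    exact ⟨Fin.tail ρ, hρ, Fin.cons_self_tail ρ⟩

theorem mem_stepVectors {u : List ELetter} {m : ℕ} {ρ : Fin (u.length + 1) → ℕ} :
    ρ ∈ stepVectors u m ↔
      ρ 0 = m ∧ ∀ i : Fin u.length, IsStep (u.get i) (ρ i.castSucc) (ρ i.succ) := by
  induction u generalizing m with
  | nil =>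
    simp only [stepVectors, Finset.mem_singleton, funext_iff]
    exact ⟨fun h => ⟨h 0, fun i => i.elim0⟩, fun h i => by rw [Fin.fin_one_eq_zero i, h.1]⟩
  | cons x u ih =>
    have forall_isStep : (∀ i : Fin (x :: u).length,
        IsStep ((x :: u).get i) (ρ i.castSucc) (ρ i.succ)) ↔
        IsStep x (ρ 0) (Fin.tail ρ 0) ∧ ∀ i : Fin u.length,
          IsStep (u.get i) (Fin.tail ρ i.castSucc) (Fin.tail ρ i.succ) := Fin.forall_fin_succ
    rw [mem_stepVectors_cons, ih, ih, forall_isStep, isStep_iff, ← and_assoc, ← or_and_right]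
    exact and_congr_right fun h => by rw [h]

theorem latticeVectors_eq_stepVectors (v : List ELetter) :
    latticeVectors v = stepVectors (nonA v) 1 := by
  ext ρ
  rw [mem_stepVectors, latticeVectors, Set.Finite.mem_toFinset]
  rfl

theorem apply_zero_of_mem_stepVectors {u : List ELetter} {m : ℕ} {ρ : Fin (u.length + 1) → ℕ}
    (hρ : ρ ∈ stepVectors u m) : ρ 0 = m :=
  (mem_stepVectors.1 hρ).1

theorem sum_stepVectors_cons (x : ELetter) (u : List ELetter) (m : ℕ)
    (ν : Fin (u.length + 2) → ℕ) :
    ∑ ρ ∈ stepVectors (x :: u) m, signedMonomial ν ρ = (m : ℤ) ^ (ν 0 + 1) *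
      (∑ ρ ∈ stepVectors u (m + 1), signedMonomial (Fin.tail ν) ρ -
        if x = .ab then 0 else ∑ ρ ∈ stepVectors u m, signedMonomial (Fin.tail ν) ρ) := by
  have sum_rise : ∑ ρ ∈ stepVectors u (m + 1),
      signedMonomial ν (Fin.cons m ρ : Fin (u.length + 2) → ℕ) =
        (m : ℤ) ^ (ν 0 + 1) * ∑ ρ ∈ stepVectors u (m + 1), signedMonomial (Fin.tail ν) ρ := by
    rw [Finset.mul_sum]
    refine Finset.sum_congr rfl fun ρ hρ => ?_
    rw [signedMonomial_cons, apply_zero_of_mem_stepVectors hρ, if_neg m.succ_ne_self.symm, one_mul]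
  have sum_level : ∑ ρ ∈ stepVectors u m,
      signedMonomial ν (Fin.cons m ρ : Fin (u.length + 2) → ℕ) =
        -((m : ℤ) ^ (ν 0 + 1) * ∑ ρ ∈ stepVectors u m, signedMonomial (Fin.tail ν) ρ) := by
    rw [Finset.mul_sum, ← Finset.sum_neg_distrib]
    refine Finset.sum_congr rfl fun ρ hρ => ?_
    rw [signedMonomial_cons, apply_zero_of_mem_stepVectors hρ, if_pos rfl]
    ring
  have disjoint_rise_level : Disjoint (stepVectors u (m + 1)) (stepVectors u m) :=
    Finset.disjoint_left.2 fun ρ hρ hρ' => m.succ_ne_self <|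
      (apply_zero_of_mem_stepVectors hρ).symm.trans (apply_zero_of_mem_stepVectors hρ')
  refine (Finset.sum_image (Fin.cons_right_injective (α := fun _ => ℕ) m).injOn).trans ?_
  split_ifs
  · rw [Finset.union_empty, sum_rise, sub_zero]
  · rw [Finset.sum_union disjoint_rise_level, sum_rise, sum_level]
    ring

theorem nVec_cons_a (v : List ELetter) : nVec (.a :: v) = nVec v + Pi.single 0 1 := by
  funext i
  refine Fin.cases ?_ (fun i => ?_) i
  · exact (List.getElem_modifyHead _).trans (dif_pos rfl)
  · exact (List.getElem_modifyHead _).trans (dif_neg (Nat.succ_ne_zero i))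

theorem latticeSum_nil (m : ℕ) : latticeSum [] m = m := by
  change ∑ ρ ∈ {fun _ : Fin 1 => m}, signedMonomial (k := 0) (nVec []) ρ = m
  simp [signedMonomial, hSteps, nVec, runs]

theorem latticeSum_cons_a (v : List ELetter) (m : ℕ) :
    latticeSum (.a :: v) m = m * latticeSum v m := by
  rw [latticeSum, nVec_cons_a, latticeSum, Finset.mul_sum]
  exact Finset.sum_congr rfl fun ρ hρ => by
    rw [← apply_zero_of_mem_stepVectors hρ]
    exact signedMonomial_add_single_zero _ _

theorem latticeSum_cons_b (v : List ELetter) (m : ℕ) :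
    latticeSum (.b :: v) m = m * (latticeSum v (m + 1) - latticeSum v m) :=
  (sum_stepVectors_cons .b (nonA v) m (nVec (.b :: v))).trans (congrArg (· * _) (pow_one _))

theorem latticeSum_cons_ab (v : List ELetter) (m : ℕ) :
    latticeSum (.ab :: v) m = m * latticeSum v (m + 1) :=
  (sum_stepVectors_cons .ab (nonA v) m (nVec (.ab :: v))).trans
    (congrArg₂ (· * ·) (pow_one _) (sub_zero _))

/-! ### Permutations obeying a word in `a`, `b` and `a+b` -/

/-- The condition that a letter imposes on a value `t` taken at the place `s`. -/
def ELetter.Holds {α : Type*} [LinearOrder α] : ELetter → (s t : α) → Prop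
  | .a, s, t => t ≤ s
  | .b, s, t => s < t
  | .ab, _, _ => True

/-- The permutation `σ` obeys the letters `w i` at all places `i`. -/
def Fits {α : Type*} [LinearOrder α] (w : α → ELetter) (σ : Perm α) : Prop :=
  ∀ i, (w i).Holds i (σ i)

section Holds

variable {α β : Type*} [LinearOrder α] [LinearOrder β]

theorem allows_ite_iff_holds (x : ELetter) (s t : α) :
    x.Allows (if s < t then Letter.b else Letter.a) ↔ x.Holds s t := by
  cases x <;> simp [ELetter.Allows, ELetter.Holds]

theorem holds_iff_of_strictMono {f : α → β} (hf : StrictMono f) (x : ELetter) (s t : α) :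
    x.Holds (f s) (f t) ↔ x.Holds s t := by
  cases x
  · exact hf.le_iff_le
  · exact hf.lt_iff_lt
  · exact Iff.rfl

end Holds

/-- Permutations with value `q` at the place `p` correspond to permutations of one place less, by
deleting `p` and `q` and closing the gaps. -/
def permFixEquiv {n : ℕ} (p q : Fin (n + 1)) :
    {σ : Perm (Fin (n + 1)) // σ p = q} ≃ Perm (Fin n) :=
  ((equivCongr (finSuccEquiv' p) (Equiv.refl _)).subtypeEquiv fun σ => by simp).trans
    ((optionSubtype q).trans (equivCongr (Equiv.refl _) (finSuccAboveEquiv q).symm))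

theorem succAbove_permFixEquiv {n : ℕ} (p q : Fin (n + 1))
    (σ : {σ : Perm (Fin (n + 1)) // σ p = q}) (i : Fin n) :
    q.succAbove (permFixEquiv p q σ i) = σ.1 (p.succAbove i) := by
  refine (congrArg Subtype.val ((finSuccAboveEquiv q).apply_symm_apply _)).trans ?_
  exact congrArg σ.1 (finSuccEquiv'_symm_some p i)

/-- A permutation amounts to its value at `p` together with a permutation of one place less. -/
def deletePlace {n : ℕ} (p : Fin (n + 1)) : Perm (Fin (n + 1)) ≃ Fin (n + 1) × Perm (Fin n) :=
  (sigmaFiberEquiv fun σ => σ p).symm.trans (sigmaEquivProdOfEquiv (permFixEquiv p))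

theorem succAbove_deletePlace_snd {n : ℕ} (p : Fin (n + 1)) (σ : Perm (Fin (n + 1))) (i : Fin n) :
    (σ p).succAbove ((deletePlace p σ).2 i) = σ (p.succAbove i) :=
  succAbove_permFixEquiv p (σ p) ⟨σ, rfl⟩ i

theorem fits_iff_deletePlace {n : ℕ} {w : Fin (n + 1) → ELetter} {p : Fin (n + 1)}
    (hp : w p = .a) (hw : ∀ i < p, w i = .ab) (σ : Perm (Fin (n + 1))) :
    Fits w σ ↔ (deletePlace p σ).1 ≤ p ∧ Fits (p.removeNth w) (deletePlace p σ).2 := by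
  rw [Fits, Fin.forall_iff_succAbove p, hp]
  refine and_congr_right fun (hσp : σ p ≤ p) => forall_congr' fun i => ?_
  rw [← succAbove_deletePlace_snd]
  rcases lt_or_ge i.castSucc p with hip | hpi
  · rw [Fin.removeNth, hw _ (by rwa [Fin.succAbove_of_castSucc_lt _ _ hip])]
    exact Iff.rfl
  · have succAbove_eq : p.succAbove i = (σ p).succAbove i := by
      rw [Fin.succAbove_of_le_castSucc _ _ hpi, Fin.succAbove_of_le_castSucc _ _ (hσp.trans hpi)]
    rw [Fin.removeNth, succAbove_eq]
    exact holds_iff_of_strictMono (Fin.strictMono_succAbove _) _ _ _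

theorem card_fits_eq_mul {n : ℕ} {w : Fin (n + 1) → ELetter} {p : Fin (n + 1)}
    (hp : w p = .a) (hw : ∀ i < p, w i = .ab) :
    Nat.card {σ // Fits w σ} = (p + 1) * Nat.card {σ // Fits (p.removeNth w) σ} := by
  calc Nat.card {σ // Fits w σ}
      = Nat.card ({q // q ≤ p} × {σ // Fits (p.removeNth w) σ}) :=
        Nat.card_congr <| ((deletePlace p).subtypeEquiv (fits_iff_deletePlace hp hw)).trans
          subtypeProdEquivProd
    _ = (p + 1) * Nat.card {σ // Fits (p.removeNth w) σ} := by
        rw [Nat.card_prod, Nat.card_eq_fintype_card, Fintype.card_subtype,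
          Finset.filter_ge_eq_Iic, Fin.card_Iic]

/-! ### Counting by the first letter other than `a+b` -/

theorem forall₂_dropLast_ofFn {α β : Type*} {n : ℕ} {R : α → β → Prop} {f : Fin n → α}
    {g : Fin n → β} :
    List.Forall₂ R (List.ofFn f).dropLast (List.ofFn g).dropLast ↔
      ∀ i : Fin n, (i : ℕ) + 1 < n → R (f i) (g i) := by
  simp only [List.forall₂_iff_get, List.length_dropLast, List.length_ofFn, List.get_eq_getElem,
    List.getElem_dropLast, List.getElem_ofFn, true_and]
  exact ⟨fun h i hi => h i (by lia) (by lia), fun h i hi _ => h ⟨i, by lia⟩ (by grind)⟩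

theorem dropLast_ofFn_getD {α : Type*} {n : ℕ} {v : List α} (hv : v.length + 1 = n) (x : α) :
    (List.ofFn fun i : Fin n => v.getD i x).dropLast = v :=
  List.ext_getElem (by simp [← hv]) fun i _ hi => by simp [hi]

theorem forall₂_permWord_iff_fits {n : ℕ} {v : List ELetter} (hv : v.length + 1 = n)
    (σ : Perm (Fin n)) :
    List.Forall₂ ELetter.Allows v (permWord σ) ↔ Fits (fun i : Fin n => v.getD i .ab) σ := by
  conv_lhs => rw [← dropLast_ofFn_getD hv .ab]
  simp only [permWord, forall₂_dropLast_ofFn, allows_ite_iff_holds]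
  refine forall_congr' fun i => ⟨fun h => ?_, fun h _ => h⟩
  by_cases hi : (i : ℕ) + 1 < n
  · exact h hi
  · have getD_last : v.getD i .ab = .ab := List.getD_eq_default _ _ (by lia)
    simp only [getD_last, ELetter.Holds]

theorem permBracket_eq_card_fits {n : ℕ} {v : List ELetter} (hv : v.length + 1 = n) :
    permBracket n v =
      Nat.card {σ : Perm (Fin n) // Fits (fun i : Fin n => v.getD i .ab) σ} :=
  Nat.card_congr (subtypeEquivRight (forall₂_permWord_iff_fits hv))

theorem permBracket_replicate_ab (d : ℕ) :
    permBracket (d + 1) (List.replicate d .ab) = (d + 1).factorial := by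
  have fits_all (σ : Perm (Fin (d + 1))) :
      Fits (fun i : Fin (d + 1) => (List.replicate d ELetter.ab).getD i .ab) σ := fun i => by
    grind [ELetter.Holds]
  rw [permBracket_eq_card_fits (by simp), Nat.card_congr (subtypeUnivEquiv fits_all),
    Nat.card_perm, Nat.card_fin]

theorem permBracket_replicate_ab_append_a (d : ℕ) (v : List ELetter) :
    permBracket (d + v.length + 2) (List.replicate d .ab ++ .a :: v) =
      (d + 1) * permBracket (d + v.length + 1) (List.replicate d .ab ++ v) := by
  let p : Fin (d + v.length + 2) := ⟨d, by lia⟩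
  let w (i : Fin (d + v.length + 2)) := (List.replicate d ELetter.ab ++ .a :: v).getD i .ab
  have hp : w p = .a := by simp [w, p]
  have hw : ∀ i < p, w i = .ab := fun i (hi : (i : ℕ) < d) => by grind
  have removeNth_w : p.removeNth w =
      fun i : Fin (d + v.length + 1) => (List.replicate d ELetter.ab ++ v).getD i .ab := by
    funext i
    rcases lt_or_ge (i : ℕ) d with hi | hi
    · rw [Fin.removeNth, Fin.succAbove_of_castSucc_lt _ _ hi]
      grind
    · rw [Fin.removeNth, Fin.succAbove_of_le_castSucc _ _ hi]
      grind
  rw [permBracket_eq_card_fits (by simp; lia), permBracket_eq_card_fits (by simp), ← removeNth_w]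
  exact card_fits_eq_mul hp hw

theorem forall₂_allows_append_ab {u v : List ELetter} {l : List Letter} :
    List.Forall₂ ELetter.Allows (u ++ .ab :: v) l ↔
      List.Forall₂ ELetter.Allows (u ++ .a :: v) l ∨
        List.Forall₂ ELetter.Allows (u ++ .b :: v) l := by
  induction u generalizing l with
  | nil =>
    rcases l with - | ⟨⟨⟩, l⟩ <;> simp [ELetter.Allows]
  | cons x u ih => cases l <;> simp [ih, and_or_left]

theorem not_forall₂_allows_append_b {u v : List ELetter} {l : List Letter}
    (h : List.Forall₂ ELetter.Allows (u ++ .a :: v) l) :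
    ¬ List.Forall₂ ELetter.Allows (u ++ .b :: v) l := by
  induction u generalizing l with
  | nil => cases l <;> simp_all [ELetter.Allows]
  | cons x u ih => cases l <;> simp_all

theorem permBracket_append_ab (n : ℕ) (u v : List ELetter) :
    permBracket n (u ++ .ab :: v) =
      permBracket n (u ++ .a :: v) + permBracket n (u ++ .b :: v) := by
  classical
  have disjoint_a_b := Pi.disjoint_iff.2 fun σ : Perm (Fin n) => Prop.disjoint_iff.2 <|
    not_and.2 (not_forall₂_allows_append_b (u := u) (v := v) (l := permWord σ))
  unfold permBracket
  rw [Nat.card_congr ((subtypeEquivRight fun σ => forall₂_allows_append_ab).trans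
    (subtypeOrEquiv _ _ disjoint_a_b)), Nat.card_sum]

theorem permBracket_replicate_ab_append (d : ℕ) (v : List ELetter) :
    (permBracket (d + v.length + 1) (List.replicate d .ab ++ v) : ℤ) =
      d.factorial * latticeSum v (d + 1) := by
  induction v generalizing d with
  | nil =>
    rw [List.append_nil, List.length_nil, add_zero, permBracket_replicate_ab, latticeSum_nil,
      Nat.factorial_succ]
    push_cast
    ring
  | cons x v ih =>
    have count_a : (permBracket (d + (v.length + 1) + 1) (List.replicate d .ab ++ .a :: v) : ℤ) =
        d.factorial * ((d + 1) * latticeSum v (d + 1)) := by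
      rw [← add_assoc, permBracket_replicate_ab_append_a, Nat.cast_mul, ih]
      push_cast
      ring
    have count_ab : (permBracket (d + (v.length + 1) + 1) (List.replicate d .ab ++ .ab :: v) : ℤ) =
        d.factorial * ((d + 1) * latticeSum v (d + 1 + 1)) := by
      rw [List.append_cons, ← List.replicate_succ', add_comm v.length, ← add_assoc d, ih,
        Nat.factorial_succ]
      push_cast
      ring
    rw [List.length_cons]
    cases x with
    | a => rw [count_a, latticeSum_cons_a]; push_cast; ring
    | ab => rw [count_ab, latticeSum_cons_ab]; push_cast; ring
    | b =>
      rw [permBracket_append_ab, Nat.cast_add, count_a] at count_ab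
      rw [latticeSum_cons_b]
      push_cast
      linear_combination count_ab

theorem permBracket_eq_sum_latticeVectors {n : ℕ} {v : List ELetter} (hv : v.length + 1 = n) :
    (permBracket n v : ℤ) =
      ∑ ρ ∈ latticeVectors v, (-1) ^ hSteps ρ * ∏ i, (ρ i : ℤ) ^ (nVec v i + 1) := by
  rw [latticeVectors_eq_stepVectors, ← hv]
  simpa [latticeSum, signedMonomial] using permBracket_replicate_ab_append 0 v

/-! ### The excedance matrix of a colored permutation -/

theorem matrixWord_eq_dropLast_ofFn {r n : ℕ} (M : Matrix (Fin r) (Fin n) Letter) :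
    matrixWord M =
      (List.ofFn fun k => M (finProdFinEquiv.symm k).1 (finProdFinEquiv.symm k).2).dropLast := by
  have place_eq (p : Fin r) (i : Fin n) (h : p * n + i < r * n) :
      (⟨p * n + i, h⟩ : Fin (r * n)) = finProdFinEquiv (p, i) :=
    Fin.ext (by simp only [finProdFinEquiv_apply_val]; ring)
  simp only [matrixWord, List.ofFn_mul, place_eq, symm_apply_apply, List.flatMap_def,
    List.ofFn_eq_map]

theorem matrixWord_eq_matrixWord_iff {r n : ℕ} {M M' : Matrix (Fin r) (Fin n) Letter} :
    matrixWord M = matrixWord M' ↔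
      ∀ (p : Fin r) (i : Fin n), (p : ℕ) + 1 < r ∨ (i : ℕ) + 1 < n → M p i = M' p i := by
  have not_last_iff (p : Fin r) (i : Fin n) :
      (finProdFinEquiv (p, i) : ℕ) + 1 < r * n ↔ (p : ℕ) + 1 < r ∨ (i : ℕ) + 1 < n := by
    obtain ⟨k, hk⟩ := Nat.exists_eq_add_of_lt p.2
    have card_eq : r * n = n * p + n + k * n := (congrArg (· * n) hk).trans (by ring)
    rw [finProdFinEquiv_apply_val, card_eq]
    rcases k.eq_zero_or_pos with rfl | hkpos
    · lia
    · have := Nat.le_mul_of_pos_left n hkpos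
      lia
  rw [matrixWord_eq_dropLast_ofFn, matrixWord_eq_dropLast_ofFn, ← List.forall₂_eq_eq_eq,
    forall₂_dropLast_ofFn, ← finProdFinEquiv.forall_congr_right, Prod.forall]
  simp only [not_last_iff, symm_apply_apply]

theorem Letter.ne_b_iff {x : Letter} : x ≠ .b ↔ x = .a := by
  cases x <;> simp

theorem Letter.eq_iff_eq_b_iff {x y : Letter} : x = y ↔ (x = .b ↔ y = .b) := by
  cases x <;> cases y <;> simp

section ColoredPerm

variable {r n : ℕ}

/-- The color that `π` adds to the letters `i^{[j]}`, all of which it maps to copies of `τ(i)`. -/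
def ColoredPerm.shift (π : ColoredPerm r n) (i : Fin n) : ZMod r :=
  π.z (π.τ i)

/-- A colored permutation amounts to its color shifts and its underlying permutation. The colors
are indexed by the place `i` instead of the value `τ(i)`, to match the columns of `M(π)`. -/
def shiftEquiv : ColoredPerm r n ≃ (Fin n → ZMod r) × Perm (Fin n) where
  toFun π := (π.shift, π.τ)
  invFun x := ⟨x.1 ∘ x.2.symm, x.2⟩
  left_inv π := by ext i <;> simp [ColoredPerm.shift]
  right_inv x := by ext i <;> simp [ColoredPerm.shift]

variable [NeZero r]

theorem excMatrix_eq_b_iff (π : ColoredPerm r n) (p : Fin r) (i : Fin n) :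
    excMatrix π p i = Letter.b ↔ (p : ℕ) < (π.shift i).val ∨ π.shift i = 0 ∧ i < π.τ i := by
  have smul_eq : π • ((i, ((p.rev : ℕ) : ZMod r)) : Fin n × ZMod r) =
      (π.τ i, ((p.rev : ℕ) : ZMod r) + π.shift i) := rfl
  have val_rev : ((p.rev : ℕ) : ZMod r).val = p.rev := ZMod.val_cast_of_lt p.rev.2
  have val_add_lt_iff : (((p.rev : ℕ) : ZMod r) + π.shift i).val < p.rev ↔
      (p : ℕ) < (π.shift i).val := by
    have := ZMod.val_lt (π.shift i)
    rw [ZMod.val_add, val_rev, Fin.val_rev]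
    rcases lt_or_ge (p : ℕ) (π.shift i).val with h | h
    · rw [Nat.mod_eq_sub_mod (by lia), Nat.mod_eq_of_lt (by lia)]; lia
    · rw [Nat.mod_eq_of_lt (by lia)]; lia
  simp only [excMatrix, ColorLT, smul_eq, val_rev, val_add_lt_iff, left_eq_add, ite_eq_left_iff,
    reduceCtorEq, imp_false, not_not]

theorem excMatrix_last_eq_a (π : ColoredPerm r n) {p : Fin r} {i : Fin n} (hp : r ≤ p + 1)
    (hi : n ≤ i + 1) : excMatrix π p i = .a := by
  have := ZMod.val_lt (π.shift i)
  rw [← Letter.ne_b_iff, Ne, excMatrix_eq_b_iff]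
  lia

theorem excWord_eq_excWord_iff {π π' : ColoredPerm r n} :
    excWord π = excWord π' ↔ excMatrix π = excMatrix π' := by
  refine ⟨fun h => ?_, congrArg matrixWord⟩
  ext p i
  by_cases hlast : (p : ℕ) + 1 < r ∨ (i : ℕ) + 1 < n
  · exact matrixWord_eq_matrixWord_iff.1 h p i hlast
  · rw [excMatrix_last_eq_a π (by lia) (by lia), excMatrix_last_eq_a π' (by lia) (by lia)]

theorem natCast_card_b_column (π : ColoredPerm r n) (i : Fin n) :
    ((Finset.univ.filter fun p => excMatrix π p i = .b).card : ZMod r) = π.shift i := by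
  simp only [excMatrix_eq_b_iff]
  by_cases h : π.shift i = 0 ∧ i < π.τ i
  · simp [h]
  · simp [h, (ZMod.val_lt (π.shift i)).le, Fin.card_filter_val_lt]

theorem excMatrix_eq_excMatrix_iff {π π' : ColoredPerm r n} :
    excMatrix π = excMatrix π' ↔
      π.shift = π'.shift ∧ ∀ i, π'.shift i = 0 → (i < π.τ i ↔ i < π'.τ i) := by
  constructor
  · intro h
    have shift_eq : π.shift = π'.shift := by
      ext i
      rw [← natCast_card_b_column, h, natCast_card_b_column]
    refine ⟨shift_eq, fun i hi => ?_⟩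
    have := Letter.eq_iff_eq_b_iff.1 (congrFun₂ h 0 i)
    simpa [excMatrix_eq_b_iff, shift_eq, hi] using this
  · rintro ⟨hshift, hτ⟩
    ext p i
    rw [Letter.eq_iff_eq_b_iff, excMatrix_eq_b_iff, excMatrix_eq_b_iff, hshift,
      and_congr_right (hτ i)]

theorem collapse_excMatrix (π : ColoredPerm r n) (i : Fin n) :
    collapse (fun p => excMatrix π p i) =
      if π.shift i = 0 then if i < π.τ i then .b else .a else .ab := by
  have forall_a : (∀ p, excMatrix π p i = .a) ↔ π.shift i = 0 ∧ ¬ i < π.τ i := by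
    simp only [← Letter.ne_b_iff, Ne, excMatrix_eq_b_iff]
    refine ⟨fun h => ?_, fun h => by simp [h]⟩
    have := h 0
    simp_all [← ZMod.val_eq_zero]
  have forall_b : (∀ p, excMatrix π p i = .b) ↔ π.shift i = 0 ∧ i < π.τ i := by
    simp only [excMatrix_eq_b_iff]
    refine ⟨fun h => (h (Fin.rev 0)).resolve_left ?_, fun h p => .inr h⟩
    have := ZMod.val_lt (π.shift i)
    simp only [Fin.val_rev, Fin.val_zero]
    lia
  unfold collapse
  simp only [forall_a, forall_b]
  split_ifs <;> simp_all

theorem holds_collapse_excMatrix_iff (π : ColoredPerm r n) (i t : Fin n) :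
    (collapse fun p => excMatrix π p i).Holds i t ↔
      (π.shift i = 0 → (i < t ↔ i < π.τ i)) := by
  rw [collapse_excMatrix]
  split_ifs with hshift hτ
  · simp only [ELetter.Holds, hshift, hτ, true_imp_iff, iff_true]
  · simp only [ELetter.Holds, hshift, hτ, true_imp_iff, iff_false, not_lt]
  · simp only [ELetter.Holds, hshift, false_imp_iff]

theorem forall₂_Psi_permWord_iff {π₀ : ColoredPerm r n} {M : Matrix (Fin r) (Fin n) Letter}
    (h₀ : excWord π₀ = matrixWord M) (σ : Perm (Fin n)) :
    List.Forall₂ ELetter.Allows (Psi M) (permWord σ) ↔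
      ∀ i, π₀.shift i = 0 → (i < σ i ↔ i < π₀.τ i) := by
  simp only [Psi, permWord, forall₂_dropLast_ofFn, allows_ite_iff_holds]
  refine forall_congr' fun i => ?_
  by_cases hi : (i : ℕ) + 1 < n
  · have column_eq : (fun p => M p i) = fun p => excMatrix π₀ p i :=
      funext fun p => (matrixWord_eq_matrixWord_iff.1 h₀ p i (.inr hi)).symm
    rw [column_eq, holds_collapse_excMatrix_iff, forall_prop_of_true hi]
  · have not_lt_apply (τ : Perm (Fin n)) : ¬ i < τ i := by lia
    simp [hi, not_lt_apply]

theorem bracket_matrixWord_eq_permBracket {π₀ : ColoredPerm r n}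
    {M : Matrix (Fin r) (Fin n) Letter} (h₀ : excWord π₀ = matrixWord M) :
    bracket r n (matrixWord M) = permBracket n (Psi M) := by
  have excWord_eq_iff (π : ColoredPerm r n) : excWord π = matrixWord M ↔
      (shiftEquiv π).1 = π₀.shift ∧
        List.Forall₂ ELetter.Allows (Psi M) (permWord (shiftEquiv π).2) := by
    rw [← h₀, excWord_eq_excWord_iff, excMatrix_eq_excMatrix_iff, forall₂_Psi_permWord_iff h₀]
    rfl
  let splitEquiv : {π : ColoredPerm r n // excWord π = matrixWord M} ≃
      {c // c = π₀.shift} × {σ : Perm (Fin n) //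
        List.Forall₂ ELetter.Allows (Psi M) (permWord σ)} :=
    (shiftEquiv.subtypeEquiv excWord_eq_iff).trans subtypeProdEquivProd
  rw [bracket, Nat.card_congr splitEquiv, Nat.card_prod, Nat.card_unique, one_mul, permBracket]

end ColoredPerm

end ColoredExc

theorem mainTheorem3 (r n : ℕ) (hr : 0 < r) (hn : 0 < n)
    (M : Matrix (Fin r) (Fin n) ColoredExc.Letter) :
    ((∃ π : ColoredExc.ColoredPerm r n,
        ColoredExc.excWord π = ColoredExc.matrixWord M) →
      ColoredExc.bracket r n (ColoredExc.matrixWord M) =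
        ColoredExc.permBracket n (ColoredExc.Psi M)) ∧
      (ColoredExc.permBracket n (ColoredExc.Psi M) : ℤ) =
        ∑ ρ ∈ ColoredExc.latticeVectors (ColoredExc.Psi M),
          (-1 : ℤ) ^ ColoredExc.hSteps ρ *
            ∏ i, (ρ i : ℤ) ^ (ColoredExc.nVec (ColoredExc.Psi M) i + 1) := by
  have : NeZero r := ⟨hr.ne'⟩
  have length_Psi : (ColoredExc.Psi M).length + 1 = n := by
    simpa [ColoredExc.Psi] using Nat.sub_add_cancel hn
  exact ⟨fun ⟨_, h₀⟩ => ColoredExc.bracket_matrixWord_eq_permBracket h₀,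
    ColoredExc.permBracket_eq_sum_latticeVectors length_Psi⟩
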